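/- Let $k$ be a field of characteristic different from $2$. An arithmetic circuit over $k$ is a finite directed acyclic multigraph whose vertices (gates) have in-degree $0$ or $2$ and in which exactly one vertex (the output) has out-degree $0$; gates of in-degree $0$ (input gates) are labelled by a constant of $k$ or a variable, and gates of in-degree $2$ are labelled by $+$ or $\times$. The polynomial computed by the circuit is the one obtained at its output, and its fat size is its total number of gates, including the input gates. The sub-circuit associated to a gate $\beta$ consists of all gates from which there is an oriented path to $\beta$, including $\beta$. The circuit is weakly-skew if every multiplication gate $\alpha$ has an arrow coming from one of its arguments, from $\beta$ to $\alpha$ say, such that this arrow is the only one connecting the sub-circuit associated to $\beta$ with the rest of the circuit. Theorem. Let $f$ be the polynomial computed by a weakly-skew circuit over $k$ of fat size $m$. Then there exist an integer $n\le 2m+1$ and a symmetric $n\times n$ matrix $A$ such that $f=\det A$ and every entry of $A$ is either an input of the circuit (the label, constant or variable, of one of its input gates) or an element of $\{0,1,-1,\tfrac12\}$. -/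

import Mathlib

/-- The label of a gate of an arithmetic circuit with gate set `V`, constants in `k` and variables
indexed by `σ`. An input gate carries a constant or a variable; a computation gate is labelled by
`+` or `×` and receives exactly two arrows, from its two arguments (which may coincide). -/
inductive Gate (k σ V : Type*) where
  | const (c : k) : Gate k σ V
  | var (x : σ) : Gate k σ V
  | add (β γ : V) : Gate k σ V
  | mul (β γ : V) : Gate k σ V

/-- The source of the first (`false`) or second (`true`) arrow received by a gate, if any. -/
def Gate.arg {k σ V : Type*} : Gate k σ V → Bool → Option V
  | .const _, _ => none
  | .var _, _ => none
  | .add β _, false => some β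
  | .add _ γ, true => some γ
  | .mul β _, false => some β
  | .mul _ γ, true => some γ

/-- An arithmetic circuit with gate set `V`: a directed acyclic (multi)graph with vertices of
in-degree `0` (inputs) or `2` (computation gates), in which exactly one vertex, the output, has
out-degree `0`. -/
structure ArithCircuit (k σ V : Type*) where
  gate : V → Gate k σ V
  acyclic : ∀ v : V, ¬ Relation.TransGen (fun β α : V => ∃ i, (gate α).arg i = some β) v v
  output : V
  eq_output_iff : ∀ v : V, v = output ↔ ∀ (α : V) (i : Bool), (gate α).arg i ≠ some v

namespace ArithCircuit

variable {k σ V : Type*}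

/-- There is at least one arrow from `β` to `α`. -/
def Arrow (C : ArithCircuit k σ V) (β α : V) : Prop :=
  ∃ i, (C.gate α).arg i = some β

/-- The sub-circuit associated to `α`: all gates from which there is an oriented path to `α`,
including `α`. -/
def subCircuit (C : ArithCircuit k σ V) (α : V) : Set V :=
  {β | Relation.ReflTransGen C.Arrow β α}

/-- The sub-circuit associated to the `i`-th argument `β` of the gate `α` is connected to the rest
of the circuit only by the `i`-th arrow received by `α`, which goes from `β` to `α`. (There is
never an arrow entering the sub-circuit of `β` from outside. Parallel arrows are different
arrows.) -/
def ClosedArg (C : ArithCircuit k σ V) (α : V) (i : Bool) : Prop :=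
  ∃ β, (C.gate α).arg i = some β ∧
    ∀ (δ ε : V) (j : Bool), (C.gate ε).arg j = some δ →
      δ ∈ C.subCircuit β → ε ∉ C.subCircuit β → ε = α ∧ j = i

/-- A circuit is weakly-skew if every multiplication gate has an argument whose sub-circuit is
closed. -/
def WeaklySkew (C : ArithCircuit k σ V) : Prop :=
  ∀ α β γ : V, C.gate α = .mul β γ → C.ClosedArg α false ∨ C.ClosedArg α true

/-- The fat size: the total number of gates, including the input gates. -/
def fatSize [Fintype V] (_C : ArithCircuit k σ V) : ℕ := Fintype.card V

/-- The inputs of the circuit: the constants and variables labelling its input gates. -/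
def inputs [CommSemiring k] (C : ArithCircuit k σ V) : Set (MvPolynomial σ k) :=
  {p | (∃ v c, C.gate v = .const c ∧ p = MvPolynomial.C c) ∨
    (∃ v x, C.gate v = .var x ∧ p = MvPolynomial.X x)}

theorem wellFounded_arrow [Finite V] (C : ArithCircuit k σ V) : WellFounded C.Arrow := by
  have : Std.Irrefl (Relation.TransGen C.Arrow) := ⟨C.acyclic⟩
  exact WellFounded.mono (Finite.wellFounded_of_trans_of_irrefl (Relation.TransGen C.Arrow))
    (fun _ _ h => Relation.TransGen.single h)

theorem arrow_add_left {C : ArithCircuit k σ V} {α β γ : V} (h : C.gate α = .add β γ) :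
    C.Arrow β α := ⟨false, by rw [h]; rfl⟩

theorem arrow_add_right {C : ArithCircuit k σ V} {α β γ : V} (h : C.gate α = .add β γ) :
    C.Arrow γ α := ⟨true, by rw [h]; rfl⟩

theorem arrow_mul_left {C : ArithCircuit k σ V} {α β γ : V} (h : C.gate α = .mul β γ) :
    C.Arrow β α := ⟨false, by rw [h]; rfl⟩

theorem arrow_mul_right {C : ArithCircuit k σ V} {α β γ : V} (h : C.gate α = .mul β γ) :
    C.Arrow γ α := ⟨true, by rw [h]; rfl⟩

/-- The polynomial computed by each gate, by recursion along the arrows. -/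
noncomputable def eval [CommSemiring k] [Finite V] (C : ArithCircuit k σ V) :
    V → MvPolynomial σ k :=
  C.wellFounded_arrow.fix fun α ih =>
    match h : C.gate α with
    | .const c => MvPolynomial.C c
    | .var x => MvPolynomial.X x
    | .add β γ => ih β (arrow_add_left h) + ih γ (arrow_add_right h)
    | .mul β γ => ih β (arrow_mul_left h) * ih γ (arrow_mul_right h)

theorem eval_eq [CommSemiring k] [Finite V] (C : ArithCircuit k σ V) (α : V) :
    C.eval α = match C.gate α with
      | .const c => MvPolynomial.C c
      | .var x => MvPolynomial.X x
      | .add β γ => C.eval β + C.eval γ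
      | .mul β γ => C.eval β * C.eval γ := by
  conv_lhs => rw [eval, WellFounded.fix_eq]
  split <;> split <;> simp_all only [reduceCtorEq, Gate.const.injEq, Gate.var.injEq,
    Gate.add.injEq, Gate.mul.injEq]
  all_goals
    rename_i h
    rw [h.1, h.2]
    rfl

/-- The polynomial computed by the circuit is the one computed by its output gate. -/
noncomputable def polynomial [CommSemiring k] [Finite V] (C : ArithCircuit k σ V) :
    MvPolynomial σ k :=
  C.eval C.output

end ArithCircuit

/-! ### Closed arguments and the multiplications enclosing a gate. -/

namespace ArithCircuit

variable {k σ V : Type*}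

/-! Fix a closed argument `inner α` of each multiplication `α`, and scale the value of each gate `v`
by the outer values of all multiplications enclosing `v`. The scaled values `x v` satisfy linear
relations: a product has the scaled value of its inner argument (`multiplier_inner`), a sum adds
those of its arguments, and an input `p` gives `p` or `p * x w`, with `w` the outer argument of the
innermost enclosing multiplication (`multiplier_eq`). At the output nothing encloses, so `x` is `f`
there. The relations are triangular for `Precedes`, and `exists_affine` keeps their coefficients
among the inputs, `0` and `1`.

Up to signs this is a system `q B = b` with `det B = ±1`. Bordering the symmetric block matrix `M =
[[0, Bᵀ], [B, 0]]` by `u = (b, e/2)`, with `e` the unit vector at the output, gives determinant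
`-det M * (uᵀ M⁻¹ u)`. The two halves of `u` each contribute half of the output coordinate of `q`,
so the result is that coordinate up to sign; the size is `2m + 1`. -/

/-- A choice, for every multiplication gate, of an argument `inner` whose sub-circuit is closed,
received by the arrow number `side`; the other argument is `outer`. -/
structure IsSkewSplit (C : ArithCircuit k σ V) (side : V → Bool) (inner outer : V → V) : Prop where
  inner_arg : ∀ {α β γ}, C.gate α = .mul β γ → (C.gate α).arg (side α) = some (inner α)
  outer_arg : ∀ {α β γ}, C.gate α = .mul β γ → (C.gate α).arg (!side α) = some (outer α)
  closed : ∀ {α β γ}, C.gate α = .mul β γ → ∀ (δ ε : V) (j : Bool), (C.gate ε).arg j = some δ →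
    δ ∈ C.subCircuit (inner α) → ε ∉ C.subCircuit (inner α) → ε = α ∧ j = side α

theorem WeaklySkew.exists_isSkewSplit {C : ArithCircuit k σ V} (hC : C.WeaklySkew) :
    ∃ side inner outer, C.IsSkewSplit side inner outer := by
  have h : ∀ α, ∃ (i : Bool) (b c : V), ∀ β γ, C.gate α = .mul β γ →
      (C.gate α).arg i = some b ∧ (C.gate α).arg (!i) = some c ∧
      ∀ (δ ε : V) (j : Bool), (C.gate ε).arg j = some δ →
        δ ∈ C.subCircuit b → ε ∉ C.subCircuit b → ε = α ∧ j = i := by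
    intro α
    by_cases hα : ∃ β γ, C.gate α = .mul β γ
    · obtain ⟨β, γ, hα⟩ := hα
      rcases hC α β γ hα with ⟨b, hb, h⟩ | ⟨b, hb, h⟩
      · exact ⟨false, b, γ, fun _ _ _ => ⟨hb, by rw [hα]; rfl, h⟩⟩
      · exact ⟨true, b, β, fun _ _ _ => ⟨hb, by rw [hα]; rfl, h⟩⟩
    · exact ⟨false, α, α, fun β γ h => absurd ⟨β, γ, h⟩ hα⟩
  choose side inner outer h using h
  exact ⟨side, inner, outer, fun h' => (h _ _ _ h').1, fun h' => (h _ _ _ h').2.1,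
    fun h' => (h _ _ _ h').2.2⟩

/-- The multiplication gates whose closed argument has `v` in its sub-circuit. -/
def enclosing (C : ArithCircuit k σ V) (inner : V → V) (v : V) : Set V :=
  {α | (∃ β γ, C.gate α = .mul β γ) ∧ v ∈ C.subCircuit (inner α)}

theorem enclosing_subset_of_arrow {C : ArithCircuit k σ V} {inner : V → V} {v w : V}
    (h : C.Arrow w v) : C.enclosing inner v ⊆ C.enclosing inner w :=
  fun _ hα => ⟨hα.1, Relation.ReflTransGen.head h hα.2⟩

theorem enclosing_output (C : ArithCircuit k σ V) {side : V → Bool} {inner outer : V → V}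
    (hs : C.IsSkewSplit side inner outer) : C.enclosing inner C.output = ∅ := by
  refine Set.eq_empty_of_forall_notMem fun α ⟨⟨β, γ, hα⟩, h⟩ => ?_
  have ho := (C.eq_output_iff C.output).1 rfl
  rcases Relation.ReflTransGen.cases_head h with h | ⟨c, ⟨i, hc⟩, -⟩
  · exact ho α (side α) (h ▸ hs.inner_arg hα)
  · exact ho c i hc

theorem exists_arrow_of_ne_output {C : ArithCircuit k σ V} {v : V} (h : v ≠ C.output) :
    ∃ w j, (C.gate w).arg j = some v := by
  by_contra! h'
  exact h ((C.eq_output_iff v).2 h')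

theorem ne_output_of_arg {C : ArithCircuit k σ V} {v w : V} {j : Bool}
    (h : (C.gate w).arg j = some v) : v ≠ C.output :=
  fun hv => (C.eq_output_iff v).1 hv w j h

namespace IsSkewSplit

variable {C : ArithCircuit k σ V} {side : V → Bool} {inner outer : V → V}

/-- An arrow can leave the closed sub-circuit of `inner α` only by being the distinguished arrow
into `α` itself. -/
theorem mem_enclosing_of_arg (hs : C.IsSkewSplit side inner outer) {v w α : V} {j : Bool}
    (h : (C.gate v).arg j = some w) (hα : α ∈ C.enclosing inner w) :
    α ∈ C.enclosing inner v ∨ α = v ∧ j = side v := by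
  obtain ⟨⟨β, γ, hm⟩, hw⟩ := hα
  by_cases hv : v ∈ C.subCircuit (inner α)
  · exact .inl ⟨⟨β, γ, hm⟩, hv⟩
  · obtain ⟨rfl, hj⟩ := hs.closed hm w v j h hw hv
    exact .inr ⟨rfl, hj⟩

theorem enclosing_outer (hs : C.IsSkewSplit side inner outer) {v β γ : V}
    (hv : C.gate v = .mul β γ) : C.enclosing inner (outer v) = C.enclosing inner v := by
  refine subset_antisymm (fun α hα => ?_) (enclosing_subset_of_arrow ⟨_, hs.outer_arg hv⟩)
  rcases hs.mem_enclosing_of_arg (hs.outer_arg hv) hα with h | ⟨-, h⟩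
  · exact h
  · simp at h

theorem enclosing_inner (hs : C.IsSkewSplit side inner outer) {v β γ : V}
    (hv : C.gate v = .mul β γ) : C.enclosing inner (inner v) = insert v (C.enclosing inner v) := by
  refine subset_antisymm (fun α hα => ?_) (Set.insert_subset ⟨⟨β, γ, hv⟩, .refl⟩
    (enclosing_subset_of_arrow ⟨_, hs.inner_arg hv⟩))
  exact (hs.mem_enclosing_of_arg (hs.inner_arg hv) hα).elim .inr fun h => .inl h.1

theorem notMem_enclosing_self (hs : C.IsSkewSplit side inner outer) (v : V) :
    v ∉ C.enclosing inner v := by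
  rintro ⟨⟨β, γ, hv⟩, h⟩
  exact C.acyclic v (Relation.TransGen.tail' h ⟨_, hs.inner_arg hv⟩)

theorem enclosing_of_not_mul (hs : C.IsSkewSplit side inner outer) {v w : V} {j : Bool}
    (h : (C.gate v).arg j = some w) (hv : ∀ β γ, C.gate v ≠ .mul β γ) :
    C.enclosing inner w = C.enclosing inner v := by
  refine subset_antisymm (fun α hα => ?_) (enclosing_subset_of_arrow ⟨j, h⟩)
  rcases hs.mem_enclosing_of_arg h hα with h | ⟨rfl, -⟩
  · exact h
  · obtain ⟨⟨β, γ, hm⟩, -⟩ := hα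
    exact absurd hm (hv β γ)

theorem arg_eq (hs : C.IsSkewSplit side inner outer) {v w β γ : V} {j : Bool}
    (h : (C.gate v).arg j = some w) (hv : C.gate v = .mul β γ) : w = inner v ∨ w = outer v := by
  have h1 := hs.inner_arg hv
  have h2 := hs.outer_arg hv
  rcases Bool.eq_or_eq_not j (side v) with rfl | rfl
  · exact .inl (Option.some.inj (h.symm.trans h1))
  · exact .inr (Option.some.inj (h.symm.trans h2))

theorem eval_eq_mul [CommSemiring k] [Finite V] (hs : C.IsSkewSplit side inner outer) {v β γ : V}
    (hv : C.gate v = .mul β γ) : C.eval v = C.eval (outer v) * C.eval (inner v) := by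
  have h1 := hs.inner_arg hv
  have h2 := hs.outer_arg hv
  rw [C.eval_eq v, hv]
  rw [hv] at h1 h2
  cases hi : side v <;> rw [hi] at h1 h2 <;> simp only [Gate.arg, Bool.not_false, Bool.not_true,
    Option.some.injEq] at h1 h2 <;> subst h1 h2
  · exact mul_comm _ _
  · rfl

end IsSkewSplit

/-! ### Well-foundedness of the evaluation order. -/

/-- The order in which gates are evaluated: the arguments of a gate come before it, and the outer
argument of a multiplication comes before all gates of the sub-circuit of the inner one. -/
def Precedes (C : ArithCircuit k σ V) (inner outer : V → V) (w v : V) : Prop :=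
  C.Arrow w v ∨ ∃ α ∈ C.enclosing inner v, w = outer α

/-- Going down an arrow enlarges the enclosing set only on entering `inner v`. The one new condition
then concerns `outer v`, an argument of `v` with the same enclosing set as `v`, so the induction
hypothesis covers it. -/
theorem IsSkewSplit.acc_precedes [Finite V] {C : ArithCircuit k σ V} {side : V → Bool}
    {inner outer : V → V} (hs : C.IsSkewSplit side inner outer) (v : V)
    (h : ∀ α ∈ C.enclosing inner v, Acc (C.Precedes inner outer) (outer α)) :
    Acc (C.Precedes inner outer) v := by
  induction v using C.wellFounded_arrow.induction with
  | _ v ih =>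
    refine ⟨_, fun w hw => ?_⟩
    rcases hw with ⟨j, hj⟩ | ⟨α, hα, rfl⟩
    · refine ih w ⟨j, hj⟩ ?_
      by_cases hv : ∃ β γ, C.gate v = .mul β γ
      · obtain ⟨β, γ, hv⟩ := hv
        have ho : Acc (C.Precedes inner outer) (outer v) :=
          ih _ ⟨_, hs.outer_arg hv⟩ (by rwa [hs.enclosing_outer hv])
        rcases hs.arg_eq hj hv with rfl | rfl
        · rw [hs.enclosing_inner hv]
          rintro α (rfl | hα)
          · exact ho
          · exact h α hα
        · rwa [hs.enclosing_outer hv]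
      · push Not at hv
        rwa [hs.enclosing_of_not_mul hj hv]
    · exact h α hα

/-- Induction from the output down to the inputs. -/
theorem induction_from_output [Finite V] (C : ArithCircuit k σ V) {p : V → Prop}
    (h0 : p C.output) (h1 : ∀ v w j, (C.gate w).arg j = some v → p w → p v) (v : V) : p v := by
  have hwf : WellFounded (Function.swap C.Arrow) := by
    have : Std.Irrefl (Relation.TransGen (Function.swap C.Arrow)) :=
      ⟨fun v h => C.acyclic v (Relation.transGen_swap.1 h)⟩
    exact WellFounded.mono
      (Finite.wellFounded_of_trans_of_irrefl (Relation.TransGen (Function.swap C.Arrow)))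
      (fun _ _ h => Relation.TransGen.single h)
  induction v using hwf.induction with
  | _ v ih =>
    by_cases hv : v = C.output
    · exact hv ▸ h0
    · obtain ⟨w, j, h⟩ := exists_arrow_of_ne_output hv
      exact h1 v w j h (ih w ⟨j, h⟩)

/-- The hypothesis of `acc_precedes` is vacuous at the output and passes from a gate to its
arguments. -/
theorem IsSkewSplit.wellFounded_precedes [Finite V] {C : ArithCircuit k σ V} {side : V → Bool}
    {inner outer : V → V} (hs : C.IsSkewSplit side inner outer) :
    WellFounded (C.Precedes inner outer) := by
  refine ⟨fun v => hs.acc_precedes v ?_⟩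
  induction v using C.induction_from_output with
  | h0 => simp [C.enclosing_output hs]
  | h1 v w j h ih =>
    by_cases hw : ∃ β γ, C.gate w = .mul β γ
    · obtain ⟨β, γ, hw⟩ := hw
      have ho := hs.acc_precedes (outer w) (by rwa [hs.enclosing_outer hw])
      rcases hs.arg_eq h hw with rfl | rfl
      · rw [hs.enclosing_inner hw]
        rintro α (rfl | hα)
        · exact ho
        · exact ih α hα
      · rwa [hs.enclosing_outer hw]
    · push Not at hw
      rwa [hs.enclosing_of_not_mul h hw]

/-! ### Scaled values and their affine relations. -/

/-- The product of the outer arguments of the multiplications enclosing a gate. -/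
noncomputable def multiplier [CommSemiring k] [Finite V] (C : ArithCircuit k σ V)
    (inner outer : V → V) (v : V) : MvPolynomial σ k :=
  ∏ α ∈ (Set.toFinite (C.enclosing inner v)).toFinset, C.eval (outer α)

namespace IsSkewSplit

variable [CommSemiring k] [Finite V] {C : ArithCircuit k σ V} {side : V → Bool}
  {inner outer : V → V}

theorem multiplier_congr {v w : V} (h : C.enclosing inner v = C.enclosing inner w) :
    C.multiplier inner outer v = C.multiplier inner outer w := by
  simp only [multiplier, h]

theorem multiplier_inner (hs : C.IsSkewSplit side inner outer) {v β γ : V}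
    (hv : C.gate v = .mul β γ) :
    C.multiplier inner outer (inner v) = C.multiplier inner outer v * C.eval (outer v) := by
  classical
  have : (Set.toFinite (C.enclosing inner (inner v))).toFinset =
      insert v (Set.toFinite (C.enclosing inner v)).toFinset := by
    ext; simp [hs.enclosing_inner hv]
  rw [multiplier, this, Finset.prod_insert (by simpa using hs.notMem_enclosing_self v), mul_comm]
  rfl

/-- Take `α` innermost: `outer α` is enclosed by exactly the other multiplications enclosing `v`, so
the whole product is the scaled value of a single gate. -/
theorem multiplier_eq (hs : C.IsSkewSplit side inner outer) (v : V) :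
    C.multiplier inner outer v = 1 ∨ ∃ α ∈ C.enclosing inner v, outer α ≠ C.output ∧
      C.multiplier inner outer v =
        C.multiplier inner outer (outer α) * C.eval (outer α) := by
  induction v using C.induction_from_output with
  | h0 => exact .inl (by simp [multiplier, C.enclosing_output hs])
  | h1 v w j h ih =>
    have key (he : C.enclosing inner v = C.enclosing inner w) :
        C.multiplier inner outer v = 1 ∨ ∃ α ∈ C.enclosing inner v, outer α ≠ C.output ∧
          C.multiplier inner outer v =
            C.multiplier inner outer (outer α) * C.eval (outer α) := by
      rwa [he, multiplier_congr he]
    by_cases hw : ∃ β γ, C.gate w = .mul β γ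
    · obtain ⟨β, γ, hw⟩ := hw
      rcases hs.arg_eq h hw with rfl | rfl
      · refine .inr ⟨w, by simp [hs.enclosing_inner hw], ne_output_of_arg (hs.outer_arg hw), ?_⟩
        rw [hs.multiplier_inner hw, multiplier_congr (hs.enclosing_outer hw)]
      · exact key (hs.enclosing_outer hw)
    · push Not at hw
      exact key (hs.enclosing_of_not_mul h hw)

end IsSkewSplit

/-- The value of every gate, times its multiplier, is an affine combination of those of earlier
gates, with coefficients among `0`, `1` and the inputs. -/
theorem IsSkewSplit.exists_affine [CommSemiring k] [Fintype V] {C : ArithCircuit k σ V}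
    {side : V → Bool} {inner outer : V → V} (hs : C.IsSkewSplit side inner outer)
    {ι : Type*} [Preorder ι] (r : V → ι)
    (hr : ∀ w v, C.Precedes inner outer w v → r w < r v) (v : V) :
    ∃ (b : MvPolynomial σ k) (a : V → MvPolynomial σ k),
      (b ∈ C.inputs ∪ {0, 1}) ∧ (∀ w, a w ∈ C.inputs ∪ {0, 1}) ∧
      (∀ w, a w ≠ 0 → r w < r v ∧ w ≠ C.output) ∧
      C.multiplier inner outer v * C.eval v =
        b + ∑ w, a w * (C.multiplier inner outer w * C.eval w) := by
  classical
  have hinput (v : V) (p : MvPolynomial σ k) (hp : p ∈ C.inputs) (hv : C.eval v = p) :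
      ∃ (b : MvPolynomial σ k) (a : V → MvPolynomial σ k),
        (b ∈ C.inputs ∪ {0, 1}) ∧ (∀ w, a w ∈ C.inputs ∪ {0, 1}) ∧
        (∀ w, a w ≠ 0 → r w < r v ∧ w ≠ C.output) ∧
        C.multiplier inner outer v * C.eval v =
          b + ∑ w, a w * (C.multiplier inner outer w * C.eval w) := by
    rcases hs.multiplier_eq v with h | ⟨α, hα, ho, h⟩
    · exact ⟨p, 0, .inl hp, by simp, by simp, by simp [h, hv]⟩
    · refine ⟨0, Pi.single (outer α) p, by simp, fun w => ?_, fun w hw => ?_, ?_⟩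
      · rcases eq_or_ne w (outer α) with rfl | hw
        · simp [hp]
        · simp [hw]
      · obtain rfl : w = outer α := by
          by_contra hw'
          simp [hw'] at hw
        exact ⟨hr _ _ (.inr ⟨α, hα, rfl⟩), ho⟩
      · rw [h, hv, Fintype.sum_eq_single (outer α) (fun w hw => by simp [hw])]
        simp [mul_comm]
  induction v using C.wellFounded_arrow.induction with
  | _ v ih =>
    match hv : C.gate v with
    | .const c => exact hinput v (MvPolynomial.C c) (.inl ⟨v, c, hv, rfl⟩) (by rw [eval_eq, hv])
    | .var x => exact hinput v (MvPolynomial.X x) (.inr ⟨v, x, hv, rfl⟩) (by rw [eval_eq, hv])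
    | .mul β γ =>
      have ha := hs.inner_arg hv
      refine ⟨0, Pi.single (inner v) 1, by simp, fun w => ?_, fun w hw => ?_, ?_⟩
      · rcases eq_or_ne w (inner v) with rfl | hw
        · simp
        · simp [hw]
      · obtain rfl : w = inner v := by
          by_contra hw'
          simp [hw'] at hw
        exact ⟨hr _ _ (.inl ⟨_, ha⟩), ne_output_of_arg ha⟩
      · rw [hs.eval_eq_mul hv, Fintype.sum_eq_single (inner v) (fun w hw => by simp [hw]),
          hs.multiplier_inner hv]
        simp [mul_assoc]
    | .add β γ =>
      have hβ : (C.gate v).arg false = some β := by rw [hv]; rfl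
      have hγ : (C.gate v).arg true = some γ := by rw [hv]; rfl
      have hm : ∀ δ ε, C.gate v ≠ .mul δ ε := by simp [hv]
      have hPβ := multiplier_congr (outer := outer) (hs.enclosing_of_not_mul hβ hm)
      have hPγ := multiplier_congr (outer := outer) (hs.enclosing_of_not_mul hγ hm)
      have hev : C.eval v = C.eval β + C.eval γ := by rw [eval_eq, hv]
      have hrβ := hr _ _ (.inl ⟨_, hβ⟩)
      have hrγ := hr _ _ (.inl ⟨_, hγ⟩)
      have hx : C.multiplier inner outer v * C.eval v =
          C.multiplier inner outer γ * C.eval γ + C.multiplier inner outer β * C.eval β := by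
        rw [hev, hPβ, hPγ]; ring
      -- it suffices to express `γ` by a combination in which `β` does not occur
      suffices ∃ (b : MvPolynomial σ k) (a : V → MvPolynomial σ k),
          (b ∈ C.inputs ∪ {0, 1}) ∧ (∀ w, a w ∈ C.inputs ∪ {0, 1}) ∧
          (∀ w, a w ≠ 0 → r w < r v ∧ w ≠ C.output) ∧ a β = 0 ∧
          C.multiplier inner outer γ * C.eval γ =
            b + ∑ w, a w * (C.multiplier inner outer w * C.eval w) by
        obtain ⟨b, a, hb, ha, har, ha0, h⟩ := this
        refine ⟨b, Function.update a β 1, hb, fun w => ?_, fun w hw => ?_, ?_⟩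
        · rcases eq_or_ne w β with rfl | hw
          · simp
          · rw [Function.update_of_ne hw]
            exact ha w
        · rcases eq_or_ne w β with rfl | hw'
          · exact ⟨hrβ, ne_output_of_arg hβ⟩
          · rw [Function.update_of_ne hw'] at hw
            exact har w hw
        · have hu : Function.update a β 1 = a + Pi.single β 1 := by
            ext1 w
            rcases eq_or_ne w β with rfl | hw
            · simp [ha0]
            · simp [hw]
          have hsum : ∑ w, (Pi.single β 1 : V → MvPolynomial σ k) w *
              (C.multiplier inner outer w * C.eval w) =
              C.multiplier inner outer β * C.eval β := by
            rw [Fintype.sum_eq_single β (fun w hw => by simp [hw])]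
            simp
          simp only [hu, Pi.add_apply, add_mul, Finset.sum_add_distrib, hsum]
          rw [hx, h, add_assoc]
      -- For a doubled argument the coefficient `2` is not allowed: one copy is replaced by its own
      -- affine expression, in which `β` cannot occur by rank.
      rcases eq_or_ne β γ with rfl | hne
      · obtain ⟨b, a, hb, ha, har, h⟩ := ih β ⟨_, hβ⟩
        refine ⟨b, a, hb, ha, fun w hw => ⟨(har w hw).1.trans hrβ, (har w hw).2⟩, ?_, h⟩
        by_contra h0
        exact lt_irrefl _ (har β h0).1
      · refine ⟨0, Pi.single γ 1, by simp, fun w => ?_, fun w hw => ?_, by simp [hne], ?_⟩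
        · rcases eq_or_ne w γ with rfl | hw
          · simp
          · simp [hw]
        · obtain rfl : w = γ := by
            by_contra hw'
            simp [hw'] at hw
          exact ⟨hrγ, ne_output_of_arg hγ⟩
        · rw [Fintype.sum_eq_single γ (fun w hw => by simp [hw])]
          simp

end ArithCircuit

/-! ### Determinants of symmetric bordered matrices. -/

namespace Matrix

variable {n R : Type*} [Fintype n] [DecidableEq n] [CommRing R]

theorem det_fromBlocks_antidiagonal_one_sq :
    (fromBlocks 0 1 1 0 : Matrix (n ⊕ n) (n ⊕ n) R).det *
      (fromBlocks 0 1 1 0 : Matrix (n ⊕ n) (n ⊕ n) R).det = 1 := by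
  rw [← det_mul, fromBlocks_multiply]
  simp

/-- Factoring out the block swap leaves a block diagonal matrix and avoids computing the sign of the
swap. -/
theorem det_fromBlocks_antidiagonal (A B : Matrix n n R) :
    (fromBlocks 0 A B 0).det =
      (fromBlocks 0 1 1 0 : Matrix (n ⊕ n) (n ⊕ n) R).det * (B.det * A.det) := by
  rw [← det_fromBlocks_zero₂₁ B 0 A, ← det_mul, fromBlocks_multiply]
  simp

/-- The determinant of a symmetric matrix bordered by a vector in its image. -/
theorem det_fromBlocks_border (M : Matrix n n R) (hM : IsUnit M.det) (z : n → R) :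
    (fromBlocks M (replicateCol Unit (M *ᵥ z)) (replicateRow Unit (M *ᵥ z)) 0).det =
      -(M.det * ((M *ᵥ z) ⬝ᵥ z)) := by
  let := M.invertibleOfIsUnitDet hM
  have h : ⅟M * replicateCol Unit (M *ᵥ z) = replicateCol Unit z := by
    rw [← replicateCol_mulVec, mulVec_mulVec, invOf_mul_self, one_mulVec]
  rw [det_fromBlocks₁₁, Matrix.mul_assoc, h, det_unique (n := Unit)]
  simp [mul_apply, dotProduct]

/-- A solution `q` of a unimodular linear system is, coordinate by coordinate, the determinant of a
symmetric matrix. -/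
theorem det_fromBlocks_symm_border (B : Matrix n n R) (hB : B.det * B.det = 1) (q : n → R)
    (h : R) (hh : h + h = 1) (o : n) :
    (fromBlocks (fromBlocks 0 Bᵀ B 0) (replicateCol Unit (Sum.elim (q ᵥ* B) (Pi.single o h)))
      (replicateRow Unit (Sum.elim (q ᵥ* B) (Pi.single o h))) 0).det =
      -((fromBlocks 0 1 1 0 : Matrix (n ⊕ n) (n ⊕ n) R).det * q o) := by
  have hBu : IsUnit B.det := IsUnit.of_mul_eq_one _ hB
  have hdet : (fromBlocks 0 Bᵀ B 0).det =
      (fromBlocks 0 1 1 0 : Matrix (n ⊕ n) (n ⊕ n) R).det := by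
    rw [det_fromBlocks_antidiagonal, det_transpose, hB, mul_one]
  have hp : B *ᵥ (B⁻¹ *ᵥ Pi.single o h) = Pi.single o h := by
    rw [mulVec_mulVec, mul_nonsing_inv _ hBu, one_mulVec]
  set p := B⁻¹ *ᵥ Pi.single o h
  have hz : fromBlocks 0 Bᵀ B 0 *ᵥ Sum.elim p q = Sum.elim (q ᵥ* B) (Pi.single o h) := by
    rw [fromBlocks_mulVec]
    simp [hp, mulVec_transpose]
  -- Here `(q B) · p = q · (B p) = h * q o`, and the second half of the border gives another `h * q
  -- o`.
  rw [← hz, det_fromBlocks_border, hz, hdet, sumElim_dotProduct_sumElim, ← dotProduct_mulVec, hp]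
  · simp only [dotProduct_single, single_dotProduct]
    linear_combination (-(fromBlocks 0 1 1 0 : Matrix (n ⊕ n) (n ⊕ n) R).det * q o) * hh
  · rw [hdet]
    exact IsUnit.of_mul_eq_one _ det_fromBlocks_antidiagonal_one_sq

/-- The determinant of a matrix that is triangular for a not necessarily injective rank. -/
theorem det_of_rank {ι : Type*} [LinearOrder ι] (B : Matrix n n R) (r : n → ι)
    (h : ∀ i j, i ≠ j → B i j ≠ 0 → r i < r j) : B.det = ∏ i, B i i := by
  let e := Fintype.equivFin n
  -- Ties in rank are broken by an arbitrary enumeration; entries between distinct indices of equal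
  -- rank vanish.
  let b : n → ι ×ₗ Fin (Fintype.card n) := fun i => toLex (r i, e i)
  have hb : Function.Injective b := fun i j hij =>
    e.injective (Prod.mk.inj (toLex.injective hij)).2
  let : LinearOrder n := LinearOrder.lift' b hb
  refine det_of_isUpperTriangular fun i j hij => ?_
  by_contra h0
  have h1 : r i < r j := h i j (by rintro rfl; exact lt_irrefl _ hij) h0
  have h2 : b j < b i := hij
  rw [Prod.Lex.toLex_lt_toLex] at h2
  rcases h2 with h2 | h2
  · exact lt_asymm h1 h2
  · exact h1.ne' h2.1

end Matrix

/-! ### Assembling the symmetric matrix. -/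

open Matrix in
theorem mainTheorem1 {k : Type*} [Field k] (hk : ringChar k ≠ 2) {σ V : Type*} [Fintype V]
    (C : ArithCircuit k σ V) (hC : C.WeaklySkew)
    (f : MvPolynomial σ k) (hf : C.polynomial = f) (m : ℕ) (hm : C.fatSize = m) :
    ∃ n : ℕ, n ≤ 2 * m + 1 ∧ ∃ A : Matrix (Fin n) (Fin n) (MvPolynomial σ k),
      A.IsSymm ∧
      (∀ i j, A i j ∈ C.inputs ∨
        A i j ∈ ({0, 1, -1, MvPolynomial.C (1 / 2 : k)} : Set (MvPolynomial σ k))) ∧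
      f = A.det := by
  classical
  obtain ⟨side, inner, outer, hs⟩ := hC.exists_isSkewSplit
  have hwf := hs.wellFounded_precedes
  have : IsWellFounded V (C.Precedes inner outer) := ⟨hwf⟩
  have hr : ∀ w v, C.Precedes inner outer w v → IsWellFounded.rank (C.Precedes inner outer) w <
      IsWellFounded.rank (C.Precedes inner outer) v := fun w v => IsWellFounded.rank_lt_of_rel
  generalize IsWellFounded.rank (C.Precedes inner outer) = r at hr
  choose b a hb ha har hx using hs.exists_affine r hr
  set x : V → MvPolynomial σ k := fun v => C.multiplier inner outer v * C.eval v with hxdef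
  have hxo : x C.output = f := by
    simp [hxdef, ← hf, ArithCircuit.polynomial, ArithCircuit.multiplier, C.enclosing_output hs]
  have hself : ∀ v, a v v = 0 := fun v => by
    by_contra h
    exact lt_irrefl _ (har v v h).1
  -- The output occurs in no relation, so its row of `B` has only the diagonal entry, whose sign can
  -- be chosen freely.
  have hout : ∀ v, a v C.output = 0 := fun v => by
    by_contra h
    exact (har v _ h).2 rfl
  have hh : (MvPolynomial.C (1 / 2 : k) : MvPolynomial σ k) + MvPolynomial.C (1 / 2 : k) = 1 := by
    have h2 : (2 : k) ≠ 0 := Ring.two_ne_zero hk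
    have : NeZero (2 : k) := ⟨h2⟩
    rw [← map_add, add_halves, map_one]
  -- `s` is the sign of the diagonal entry at the output
  obtain ⟨s, hs1, hsc⟩ : ∃ s : MvPolynomial σ k, (s = 1 ∨ s = -1) ∧
      s = -(fromBlocks 0 1 1 0 : Matrix (V ⊕ V) (V ⊕ V) (MvPolynomial σ k)).det := by
    refine ⟨_, ?_, rfl⟩
    rcases mul_self_eq_one_iff.1
      (det_fromBlocks_antidiagonal_one_sq (n := V) (R := MvPolynomial σ k)) with h | h <;>
      simp [h]
  have hss : s * s = 1 := by rcases hs1 with rfl | rfl <;> ring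
  -- Off the diagonal the coefficients must appear as `a`, since `-a` might not be an allowed entry.
  -- Hence the diagonal `-1` and the solution `-x`; at the output, `s` corrects the sign of the
  -- final determinant.
  let d : V → MvPolynomial σ k := fun v => if v = C.output then s else -1
  have hd : ∀ v, d v = 1 ∨ d v = -1 := fun v => by
    by_cases hv : v = C.output
    · simpa [d, hv] using hs1
    · simp [d, hv]
  let B : Matrix V V (MvPolynomial σ k) := of fun w v => if w = v then d v else a v w
  have hBdet : B.det * B.det = 1 := by
    rw [det_of_rank B r fun w v hwv h => (har v w (by simpa [B, hwv] using h)).1,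
      ← Finset.prod_mul_distrib]
    refine Finset.prod_eq_one fun v _ => ?_
    rcases hd v with h | h <;> simp [B, h]
  let q : V → MvPolynomial σ k := fun v => if v = C.output then s * f else -x v
  have hq : q ᵥ* B = b := by
    ext1 v
    have h1 : ∀ w, q w * B w v = (if w = v then q v * d v else 0) + -(a v w * x w) := by
      intro w
      by_cases hwv : w = v
      · subst hwv
        simp [B, hself]
      · by_cases hw : w = C.output
        · subst hw
          simp [B, hwv, hout]
        · simp [B, hwv, hw, q, mul_comm]
    have h2 : q v * d v = x v := by
      by_cases hv : v = C.output
      · subst hv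
        simp only [q, d, if_true, hxo]
        linear_combination f * hss
      · simp [q, d, hv]
    simp only [vecMul, dotProduct, h1, Finset.sum_add_distrib, Finset.sum_neg_distrib,
      Finset.sum_ite_eq', Finset.mem_univ, if_true, h2]
    linear_combination hx v
  have hdet := det_fromBlocks_symm_border B hBdet q _ hh C.output
  rw [hq] at hdet
  have hallowed : ∀ p : MvPolynomial σ k, p ∈ C.inputs ∪ {0, 1} → p ∈ C.inputs ∨
      p ∈ ({0, 1, -1, MvPolynomial.C (1 / 2 : k)} : Set (MvPolynomial σ k)) := by
    rintro p (h | rfl | rfl) <;> simp [*]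
  have hBallowed : ∀ w v, B w v ∈ C.inputs ∨
      B w v ∈ ({0, 1, -1, MvPolynomial.C (1 / 2 : k)} : Set (MvPolynomial σ k)) := by
    intro w v
    by_cases hwv : w = v
    · rcases hd v with h | h <;> simp [B, hwv, h]
    · simpa only [B, of_apply, if_neg hwv] using hallowed _ (ha v w)
  have huallowed : ∀ i, (Sum.elim b (Pi.single C.output (MvPolynomial.C (1 / 2 : k))) :
      V ⊕ V → MvPolynomial σ k) i ∈ C.inputs ∨
      (Sum.elim b (Pi.single C.output (MvPolynomial.C (1 / 2 : k))) :
      V ⊕ V → MvPolynomial σ k) i ∈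
        ({0, 1, -1, MvPolynomial.C (1 / 2 : k)} : Set (MvPolynomial σ k)) := by
    rintro (v | v)
    · exact hallowed _ (hb v)
    · by_cases hv : v = C.output
      · subst hv; simp
      · simp [hv]
  let e : (V ⊕ V) ⊕ Unit ≃ Fin (2 * m + 1) := Fintype.equivFinOfCardEq (by
    simp [← hm, ArithCircuit.fatSize, two_mul])
  refine ⟨2 * m + 1, le_rfl, reindex e e (fromBlocks (fromBlocks 0 Bᵀ B 0)
    (replicateCol Unit (Sum.elim b (Pi.single C.output (MvPolynomial.C (1 / 2)))))
    (replicateRow Unit (Sum.elim b (Pi.single C.output (MvPolynomial.C (1 / 2))))) 0),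
    ?_, fun i j => ?_, ?_⟩
  · rw [IsSymm, reindex_apply, transpose_submatrix, fromBlocks_transpose, fromBlocks_transpose]
    simp
  · simp only [reindex_apply, submatrix_apply]
    rcases e.symm i with (i | i) | i <;> rcases e.symm j with (j | j) | j
    · simp
    · exact hBallowed j i
    · exact huallowed (.inl i)
    · exact hBallowed i j
    · simp
    · exact huallowed (.inr i)
    · exact huallowed (.inl j)
    · exact huallowed (.inr j)
    · simp
  · rw [det_reindex_self]
    refine Eq.trans ?_ hdet.symm
    simp only [q, if_true]
    linear_combination (-f) * hss + s * f * hsc
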